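/- For $p\in[0,1]$ let $\mu_p$ be the Bernoulli $p$-measure on Cantor space $2^\omega$, i.e. $\mu_p([\sigma])=p^{\#_0(\sigma)}(1-p)^{\#_1(\sigma)}$ for every finite binary string $\sigma$, where $[\sigma]$ is the set of infinite sequences extending $\sigma$ and $\#_i(\sigma)$ is the number of occurrences of $i$ in $\sigma$. A Borel probability measure $\xi$ on $2^\omega$ is computable if the reals $\xi([\sigma])$ are computable uniformly in $\sigma$. A $\mu$-Martin-Löf test relative to $z\in 2^\omega$ is a sequence $(U_i)_{i\in\omega}$ of uniformly $\Sigma^{0,z}_1$ subsets of $2^\omega$ with $\mu(U_i)\le 2^{-i}$ for all $i$. A sequence $x\in2^\omega$ is $\xi$-random (for a computable measure $\xi$) if $x\notin\bigcap_i U_i$ for every $\xi$-Martin-Löf test $(U_i)_i$ without oracle, and it is $\mu_p$-random if $x\notin\bigcap_i U_i$ for every $\mu_p$-Martin-Löf test $(U_i)_i$ relative to (the binary expansion of) $p$. **Theorem** (no computable mixture of Bernoulli measures includes all computable Bernoulli measures). There is no computable probability measure $\xi$ on $2^\omega$ such that for every computable real $c\in[0,1]$ there is a sequence $x\in 2^\omega$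 that is both $\xi$-random and $\mu_c$-random. In particular, no computable mixture of Bernoulli measures has this property. -/

import Mathlib

namespace CantorRandomness

open MeasureTheory

/-- Cantor space: infinite binary sequences, with `false` for the symbol 0 and `true` for 1. -/
abbrev Cantor : Type := ℕ → Bool

/-- The basic clopen set of all infinite sequences that extend the finite string `σ`. -/
def cylinder (σ : List Bool) : Set Cantor :=
  {x | ∀ (i : ℕ) (h : i < σ.length), x i = σ[i]}

/-- A family of real numbers is uniformly computable: a computable function produces, from an
index `a` and a precision `n`, a dyadic rational (the numerator being given as a difference of
two natural numbers) that is within `2 ^ (-n)` of `r a`. -/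
def UniformlyComputableReal {α : Type} [Primcodable α] (r : α → ℝ) : Prop :=
  ∃ f g : α → ℕ → ℕ, Computable₂ f ∧ Computable₂ g ∧
    ∀ (a : α) (n : ℕ), |r a - ((f a n : ℝ) - (g a n : ℝ)) / 2 ^ n| ≤ 1 / 2 ^ n

/-- A computable real number. -/
def ComputableReal (r : ℝ) : Prop :=
  UniformlyComputableReal (fun _ : Unit => r)

/-- A measure on Cantor space is computable if the measures of the basic clopen sets are
computable real numbers, uniformly in the string. -/
def ComputableMeasure (μ : Measure Cantor) : Prop :=
  UniformlyComputableReal (fun σ : List Bool => μ.real (cylinder σ))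

/-- An infinite binary sequence as an oracle. -/
def oracle (z : Cantor) : ℕ →. ℕ :=
  fun n => Part.some (z n).toNat

/-- The predicate `P` is recursively enumerable relative to the oracle `z`. -/
def REPredIn {α : Type} [Primcodable α] (z : Cantor) (P : α → Prop) : Prop :=
  RecursiveIn {oracle z} (fun a => Part.assert (P a) fun _ => Part.some ())

/-- A uniformly `Σ⁰₁` sequence of subsets of Cantor space, relative to `z`: the sets `U i` are
unions of basic clopen sets, enumerated uniformly in `i` with oracle `z`. -/
def UniformlySigma01 (z : Cantor) (U : ℕ → Set Cantor) : Prop :=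
  ∃ W : ℕ × List Bool → Prop, REPredIn z W ∧
    ∀ i, U i = {x | ∃ σ, W (i, σ) ∧ x ∈ cylinder σ}

/-- A `μ`-Martin-Löf test relative to `z`. -/
def IsMLTest (μ : Measure Cantor) (z : Cantor) (U : ℕ → Set Cantor) : Prop :=
  UniformlySigma01 z U ∧ ∀ i, μ (U i) ≤ (2⁻¹ : ENNReal) ^ i

/-- `x` is `μ`-Martin-Löf random relative to `z`. -/
def MLRandomRel (μ : Measure Cantor) (z x : Cantor) : Prop :=
  ∀ U : ℕ → Set Cantor, IsMLTest μ z U → x ∉ ⋂ i, U i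

/-- `x` is `μ`-Martin-Löf random (no oracle, that is, the oracle `000…`). -/
def MLRandom (μ : Measure Cantor) (x : Cantor) : Prop :=
  MLRandomRel μ (fun _ => false) x

/-- The Bernoulli `p`-measure on Cantor space: the bits are independent, and each of them is 0
with probability `p` and 1 with probability `1 - p`. -/
noncomputable def bernoulliCantor (p : unitInterval) : Measure Cantor :=
  Measure.infinitePi fun _ : ℕ => ProbabilityTheory.bernoulliMeasure false true p

/-- The Bernoulli `p`-measure takes the value `p ^ #₀(σ) * (1 - p) ^ #₁(σ)` on the basic clopen
set given by the string `σ`. -/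
theorem bernoulliCantor_cylinder (p : unitInterval) (σ : List Bool) :
    (bernoulliCantor p).real (cylinder σ) =
      (p : ℝ) ^ σ.count false * (1 - (p : ℝ)) ^ σ.count true := by
  have hset : cylinder σ =
      Set.pi (Finset.range σ.length : Set ℕ) (fun i => {σ.getD i false}) := by
    ext x
    simp only [cylinder, Set.mem_ofPred_eq, Set.mem_pi, Finset.coe_range, Set.mem_Iio,
      Set.mem_singleton_iff]
    refine forall_congr' fun i => forall_congr' fun h => ?_
    rw [List.getD_eq_getElem _ _ h]
  have hone : ∀ b : Bool, (ProbabilityTheory.bernoulliMeasure false true p).real {b} =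
      if b then 1 - (p : ℝ) else (p : ℝ) := by
    intro b
    rw [ProbabilityTheory.bernoulliMeasure_real_apply p (measurableSet_singleton b)]
    cases b <;> simp
  have hprod : ∀ τ : List Bool,
      ∏ i ∈ Finset.range τ.length,
        (ProbabilityTheory.bernoulliMeasure false true p).real {τ.getD i false} =
      (p : ℝ) ^ τ.count false * (1 - (p : ℝ)) ^ τ.count true := by
    intro τ
    induction τ with
    | nil => simp
    | cons b τ ih =>
      rw [List.length_cons, Finset.prod_range_succ']
      simp only [List.getD_cons_succ, List.getD_cons_zero]
      rw [ih, hone]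
      cases b <;> simp <;> ring
  rw [← hprod, hset, bernoulliCantor, measureReal_def, Measure.infinitePi_pi _
    (fun i _ => measurableSet_singleton _), ENNReal.toReal_prod]
  rfl

/-- The sequence of binary digits of a real `p ∈ [0,1]` after the binary point, the one that is
not eventually 1 if `p` is a dyadic rational (and `000…` for `p = 1`). -/
noncomputable def binaryDigits (p : unitInterval) : Cantor :=
  fun n => decide (⌊(p : ℝ) * 2 ^ (n + 1)⌋₊ % 2 = 1)

/-- `x` is Bernoulli `p`-random: it passes every `μ_p`-Martin-Löf test relative to `p`. -/
def BernoulliRandom (p : unitInterval) (x : Cantor) : Prop :=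
  MLRandomRel (bernoulliCantor p) (binaryDigits p) x

end CantorRandomness

/-!
The real `c` is built by diagonalizing against `ξ` along nested dyadic intervals. The interval
chosen at stage `k` contains many well separated candidates for the next one. The events that
the frequency of zeros among the first `N` bits is close to the candidate are pairwise disjoint, so
if there are enough candidates then one of these events has `ξ`-measure below `2 ^ (-k)`, and such a
candidate can be found effectively because `ξ` is computable. The common point `c` of the chosen
intervals is a computable real, and if `N` is large enough then Chebyshev's inequality gives the
`k`-th chosen event `μ_c`-measure at least `1 - 2 ^ (-k)`. By the effective Borel–Cantelli lemma, a
`ξ`-random sequence lies in only finitely many of the chosen events, whereas a `μ_c`-random sequence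
lies in all but finitely many of them.
-/

namespace CantorRandomness

open MeasureTheory ProbabilityTheory Set Filter

section Computability

variable {α β : Type} [Primcodable α] [Primcodable β]

theorem computable_two_pow {f : α → ℕ} (hf : Computable f) : Computable fun a ↦ 2 ^ f a :=
  (Primrec₂.unpaired'.1 Nat.Primrec.pow).to_comp.comp (.const 2) hf

theorem primrec_list_count {γ : Type} [Primcodable γ] [DecidableEq γ] (c : γ) :
    Primrec fun l : List γ ↦ l.count c := by
  have hc : PrimrecPred fun b : γ ↦ b = c := Primrec.eq.comp .id (.const c)
  refine (Primrec.list_length.comp (Primrec.listFilter hc)).of_eq fun l ↦ ?_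
  rw [List.count, List.countP_eq_length_filter]
  rfl

theorem computable_list_map_sum {L : α → List β} {g : α → β → ℕ} (hL : Computable L)
    (hg : Computable₂ g) : Computable fun a ↦ ((L a).map (g a)).sum := by
  let entry : α → ℕ → ℕ := fun a i ↦ ((L a)[i]?.map (g a)).getD 0
  have hentry : Computable₂ entry :=
    .option_getD (.option_map (Computable.list_getElem?.comp (hL.comp .fst) .snd)
      (hg.comp (.comp .fst .fst) .snd)) (.const 0)
  have hrec : Computable fun a ↦
      Nat.rec (motive := fun _ ↦ ℕ) 0 (fun i s ↦ s + entry a i) (L a).length :=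
    Computable.nat_rec (h := fun a q ↦ q.2 + entry a q.1) (Computable.list_length.comp hL)
      (.const 0) (Primrec.nat_add.to_comp.comp (.comp .snd .snd)
        (hentry.comp .fst (.comp .fst .snd)))
  refine hrec.of_eq fun a ↦ ?_
  have hpartial (n : ℕ) : Nat.rec (motive := fun _ ↦ ℕ) 0 (fun i s ↦ s + entry a i) n =
      (((L a).take n).map (g a)).sum := by
    induction n with
    | zero => simp
    | succ n ih =>
      simp only [ih, entry, List.take_add_one, List.map_append, List.sum_append]
      cases (L a)[n]? <;> simp
  rw [hpartial, List.take_length]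

/-- The quotient `u / b` rounded to the nearest integer. -/
def roundDiv (u b : ℕ) : ℕ := (2 * u + b) / (2 * b)

theorem computable_roundDiv {f g : α → ℕ} (hf : Computable f) (hg : Computable g) :
    Computable fun a ↦ roundDiv (f a) (g a) :=
  Primrec.nat_div.to_comp.comp
    (Primrec.nat_add.to_comp.comp (Primrec.nat_double.to_comp.comp hf) hg)
    (Primrec.nat_double.to_comp.comp hg)

theorem abs_div_sub_roundDiv_le (u : ℕ) {b : ℕ} (hb : 0 < b) :
    |(u : ℝ) / b - roundDiv u b| ≤ 1 / 2 := by
  have hb' : (0 : ℝ) < b := by exact_mod_cast hb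
  have hlower : ((roundDiv u b : ℕ) : ℝ) * (2 * b) ≤ 2 * u + b := by
    exact_mod_cast Nat.div_mul_le_self (2 * u + b) (2 * b)
  have hupper : (2 * u + b : ℝ) < (roundDiv u b + 1) * (2 * b) := by
    exact_mod_cast Nat.lt_mul_of_div_lt (Nat.lt_succ_self ((2 * u + b) / (2 * b))) (by positivity)
  rw [div_sub' hb'.ne', abs_div, abs_of_pos hb', div_le_iff₀ hb', abs_le]
  constructor <;> linarith

theorem abs_sub_div_sub_roundDiv_le (u v : ℕ) {b : ℕ} (hb : 0 < b) :
    |((u : ℝ) - v) / b - (roundDiv (u - v) b - roundDiv (v - u) b)| ≤ 1 / 2 := by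
  have hzero : roundDiv 0 b = 0 := by
    rw [roundDiv, mul_zero, zero_add, Nat.div_eq_of_lt (by omega)]
  rcases le_total v u with h | h
  · simpa [Nat.sub_eq_zero_of_le h, hzero, Nat.cast_sub h] using abs_div_sub_roundDiv_le (u - v) hb
  · have hvu := abs_div_sub_roundDiv_le (v - u) hb
    rw [Nat.cast_sub h, ← abs_neg] at hvu
    rw [Nat.sub_eq_zero_of_le h, hzero, Nat.cast_zero]
    convert hvu using 2
    ring

theorem exists_computable_of_forall_exists {p : α → ℕ → Bool} (hp : Computable₂ p)
    (h : ∀ a, ∃ n, p a n = true) : ∃ f : α → ℕ, Computable f ∧ ∀ a, p a (f a) = true := by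
  have hP : ComputablePred fun q : α × ℕ ↦ p q.1 q.2 = true :=
    Computable.computablePred (hp.of_eq fun _ ↦ by simp)
  exact ⟨_, Computable.find hP h, fun a ↦ Nat.find_spec (h a)⟩

theorem rePred_exists {p : α → ℕ → Bool} (hp : Computable₂ p) :
    REPred fun a ↦ ∃ n, p a n = true := by
  refine (Partrec.rfind (p := fun a n ↦ Part.some (p a n)) hp).dom_re.of_eq fun a ↦ ?_
  refine Nat.rfind_dom'.trans ⟨fun ⟨n, hn, _⟩ ↦ ⟨n, (Part.mem_some_iff.1 hn).symm⟩, ?_⟩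
  exact fun ⟨n, hn⟩ ↦ ⟨n, Part.mem_some_iff.2 hn.symm, fun _ ↦ trivial⟩

namespace UniformlyComputableReal

theorem comp {r : β → ℝ} (hr : UniformlyComputableReal r) {u : α → β} (hu : Computable u) :
    UniformlyComputableReal fun a ↦ r (u a) := by
  obtain ⟨f, g, hf, hg, hfg⟩ := hr
  exact ⟨fun a ↦ f (u a), fun a ↦ g (u a), hf.comp (hu.comp .fst) .snd, hg.comp (hu.comp .fst) .snd,
    fun a ↦ hfg (u a)⟩

theorem of_dyadic_approx {r : α → ℝ} {f g e : α → ℕ → ℕ} (hf : Computable₂ f) (hg : Computable₂ g)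
    (he : Computable₂ e)
    (h : ∀ a n, |r a - ((f a n : ℝ) - g a n) / 2 ^ e a n| ≤ 1 / 2 ^ n) :
    UniformlyComputableReal r := by
  let scaled (f : α → ℕ → ℕ) (a : α) (n : ℕ) : ℕ := 2 ^ n * f a (n + 1)
  have hscaled {f : α → ℕ → ℕ} (hf : Computable₂ f) : Computable₂ (scaled f) :=
    Primrec.nat_mul.to_comp.comp (computable_two_pow .snd) (hf.comp .fst (.comp .succ .snd))
  have hround {f g : α → ℕ → ℕ} (hf : Computable₂ f) (hg : Computable₂ g) :
      Computable₂ fun a n ↦ roundDiv (scaled f a n - scaled g a n) (2 ^ e a (n + 1)) :=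
    computable_roundDiv (Primrec.nat_sub.to_comp.comp (hscaled hf) (hscaled hg))
      (computable_two_pow (he.comp .fst (.comp .succ .snd)))
  refine ⟨_, _, hround hf hg, hround hg hf, fun a n ↦ ?_⟩
  set x : ℝ := ((f a (n + 1) : ℝ) - g a (n + 1)) / 2 ^ e a (n + 1)
  set y : ℝ := (roundDiv (scaled f a n - scaled g a n) (2 ^ e a (n + 1)) : ℝ) -
    roundDiv (scaled g a n - scaled f a n) (2 ^ e a (n + 1))
  have hrx : |r a - x| ≤ 1 / 2 ^ (n + 1) := h a (n + 1)
  have hxy : |2 ^ n * x - y| ≤ 1 / 2 := by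
    have := abs_sub_div_sub_roundDiv_le (scaled f a n) (scaled g a n)
      (b := 2 ^ e a (n + 1)) (by positivity)
    push_cast [scaled] at this
    rwa [← mul_sub, mul_div_assoc] at this
  have hxy' : |x - y / 2 ^ n| ≤ 1 / 2 ^ (n + 1) := by
    have hpos : (0 : ℝ) < 2 ^ n := by positivity
    have hscale : x - y / 2 ^ n = (2 ^ n * x - y) / 2 ^ n := by field_simp
    rw [hscale, abs_div, abs_of_pos hpos, pow_succ', ← div_div]
    exact div_le_div_of_nonneg_right hxy hpos.le
  calc |r a - y / 2 ^ n| ≤ |r a - x| + |x - y / 2 ^ n| := abs_sub_le _ _ _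
    _ ≤ 1 / 2 ^ (n + 1) + 1 / 2 ^ (n + 1) := add_le_add hrx hxy'
    _ = 1 / 2 ^ n := by ring

theorem inv_two_pow {l : α → ℕ} (hl : Computable l) :
    UniformlyComputableReal fun a ↦ (2⁻¹ : ℝ) ^ l a :=
  of_dyadic_approx (f := fun _ _ ↦ 1) (g := fun _ _ ↦ 0) (e := fun a _ ↦ l a) (.const 1) (.const 0)
    (hl.comp .fst) fun a n ↦ by simp

theorem cond {r : α → ℝ} (hr : UniformlyComputableReal r) {p : α → Bool} (hp : Computable p) :
    UniformlyComputableReal fun a ↦ bif p a then r a else 0 := by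
  obtain ⟨f, g, hf, hg, hfg⟩ := hr
  refine ⟨fun a n ↦ bif p a then f a n else 0, fun a n ↦ bif p a then g a n else 0,
    .cond (hp.comp .fst) hf (.const 0), .cond (hp.comp .fst) hg (.const 0), fun a n ↦ ?_⟩
  cases h : p a
  · simp [h]
  · simpa [h] using hfg a n

theorem list_map_sum {L : α → List β} {r : α × β → ℝ} (hL : Computable L)
    (hr : UniformlyComputableReal r) :
    UniformlyComputableReal fun a ↦ ((L a).map fun b ↦ r (a, b)).sum := by
  obtain ⟨f, g, hf, hg, hfg⟩ := hr
  -- Approximating each summand up to `2 ^ -(n + length)` leaves a total error of at most `2 ^ -n`.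
  let e : α → ℕ → ℕ := fun a n ↦ n + (L a).length
  have he : Computable₂ e :=
    Primrec.nat_add.to_comp.comp .snd (Computable.list_length.comp (hL.comp .fst))
  have hsum {f : α × β → ℕ → ℕ} (hf : Computable₂ f) :
      Computable₂ fun a n ↦ ((L a).map fun b ↦ f (a, b) (e a n)).sum :=
    computable_list_map_sum (α := α × ℕ) (L := fun q ↦ L q.1)
      (g := fun q b ↦ f (q.1, b) (e q.1 q.2)) (hL.comp .fst)
      (hf.comp (.pair (.comp .fst .fst) .snd) (he.comp (.comp .fst .fst) (.comp .snd .fst)))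
  refine of_dyadic_approx (hsum hf) (hsum hg) he fun a n ↦ ?_
  have herr (l : List β) (N : ℕ) : |(l.map fun b ↦ r (a, b)).sum -
      (((l.map fun b ↦ f (a, b) N).sum : ℕ) - ((l.map fun b ↦ g (a, b) N).sum : ℕ) : ℝ) / 2 ^ N| ≤
      l.length / 2 ^ N := by
    induction l with
    | nil => simp
    | cons b l ih =>
      have := (abs_add_le _ _).trans (add_le_add (hfg (a, b) N) ih)
      simp only [List.map_cons, List.sum_cons, List.length_cons, Nat.cast_add, Nat.cast_one]
      refine (congrArg abs ?_).trans_le (this.trans_eq ?_) <;> ring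
  refine (herr _ _).trans ?_
  rw [div_le_div_iff₀ (by positivity) (by positivity), one_mul, pow_add, mul_comm]
  gcongr
  exact_mod_cast Nat.lt_two_pow_self.le

theorem exists_computable_lt_iff {r s : α → ℝ} (hr : UniformlyComputableReal r)
    (hs : UniformlyComputableReal s) :
    ∃ p : α → ℕ → Bool, Computable₂ p ∧ ∀ a, r a < s a ↔ ∃ n, p a n = true := by
  obtain ⟨f, g, hf, hg, hfg⟩ := hr
  obtain ⟨f', g', hf', hg', hfg'⟩ := hs
  have hadd {u v : α → ℕ → ℕ} (hu : Computable₂ u) (hv : Computable₂ v) :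
      Computable₂ fun a n ↦ u a n + v a n := Primrec.nat_add.to_comp.comp hu hv
  refine ⟨fun a n ↦ decide (f a n + g' a n + 2 < f' a n + g a n),
    Primrec.nat_lt.decide.to_comp.comp (hadd (hadd hf hg') (Computable.const 2).to₂)
      (hadd hf' hg),
    fun a ↦ ?_⟩
  simp only [decide_eq_true_eq]
  -- Both approximations are within `2 ^ -n`, so a gap of more than `2` units certifies
  -- `r a < s a`, and conversely `r a < s a` forces such a gap as soon as `4 * 2 ^ -n < s a - r a`.
  have hgap (n : ℕ) : f a n + g' a n + 2 < f' a n + g a n ↔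
      ((f a n : ℝ) - g a n) / 2 ^ n + 2 * (1 / 2 ^ n) < ((f' a n : ℝ) - g' a n) / 2 ^ n := by
    rw [mul_one_div, ← add_div, div_lt_div_iff_of_pos_right (pow_pos two_pos n),
      ← Nat.cast_lt (α := ℝ)]
    push_cast
    constructor <;> intro h <;> linarith
  constructor
  · intro h
    obtain ⟨n, hn⟩ := exists_pow_lt_of_lt_one (y := (1 / 2 : ℝ)) (div_pos (sub_pos.2 h) four_pos)
      one_half_lt_one
    rw [one_div_pow] at hn
    refine ⟨n, (hgap n).2 ?_⟩
    linarith [(abs_le.1 (hfg a n)).1, (abs_le.1 (hfg' a n)).2]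
  · rintro ⟨n, hn⟩
    linarith [(hgap n).1 hn, (abs_le.1 (hfg a n)).2, (abs_le.1 (hfg' a n)).1]

theorem exists_computable_selection {r : α × ℕ → ℝ} {s : α → ℝ} {b : α → ℕ}
    (hr : UniformlyComputableReal r) (hs : UniformlyComputableReal s) (hb : Computable b)
    (h : ∀ a, ∃ j < b a, r (a, j) < s a) :
    ∃ f : α → ℕ, Computable f ∧ ∀ a, f a < b a ∧ r (a, f a) < s a := by
  obtain ⟨p, hp, hlt⟩ := exists_computable_lt_iff hr (hs.comp .fst)
  have hunpair : Computable fun q : α × ℕ ↦ q.2.unpair := Computable.unpair.comp .snd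
  have hunpair₁ : Computable fun q : α × ℕ ↦ q.2.unpair.1 := Computable.fst.comp hunpair
  have hsearch : Computable₂ fun (a : α) (N : ℕ) ↦
      decide (N.unpair.1 < b a) && p (a, N.unpair.1) N.unpair.2 :=
    Primrec.and.to_comp.comp
      (Primrec.nat_lt.decide.to_comp.comp hunpair₁ (hb.comp .fst))
      (hp.comp (.pair .fst hunpair₁) (Computable.snd.comp hunpair))
  obtain ⟨N, hN, hNp⟩ := exists_computable_of_forall_exists hsearch fun a ↦ by
    obtain ⟨j, hj, hja⟩ := h a
    obtain ⟨n, hn⟩ := (hlt (a, j)).1 hja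
    exact ⟨Nat.pair j n, by simp [hj, hn]⟩
  simp only [Bool.and_eq_true, decide_eq_true_eq] at hNp
  exact ⟨fun a ↦ (N a).unpair.1, Computable.fst.comp (Computable.unpair.comp hN),
    fun a ↦ ⟨(hNp a).1, (hlt _).2 ⟨_, (hNp a).2⟩⟩⟩

end UniformlyComputableReal

end Computability

section ClopenSets

/-- The list of all binary strings of length `n`. -/
def strings : ℕ → List (List Bool)
  | 0 => [[]]
  | n + 1 => (strings n).map (List.cons false) ++ (strings n).map (List.cons true)

theorem primrec_strings : Primrec strings := by
  have hcons (b : Bool) : Primrec fun p : ℕ × List (List Bool) ↦ p.2.map (List.cons b) :=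
    Primrec.list_map .snd (Primrec.list_cons.comp (.const b) .snd)
  refine (Primrec.nat_rec₁ [[]] (f := fun _ L ↦ L.map (List.cons false) ++ L.map (List.cons true))
    (Primrec.list_append.comp (hcons false) (hcons true))).of_eq fun n ↦ ?_
  induction n with
  | zero => rfl
  | succ n ih => simp only [ih, strings]

theorem mem_strings {n : ℕ} {σ : List Bool} : σ ∈ strings n ↔ σ.length = n := by
  induction n generalizing σ with
  | zero => simp [strings]
  | succ n ih =>
    cases σ with
    | nil => simp [strings]
    | cons b σ => cases b <;> simp [strings, ih]

theorem nodup_strings (n : ℕ) : (strings n).Nodup := by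
  induction n with
  | zero => simp [strings]
  | succ n ih =>
    rw [strings, List.nodup_append]
    exact ⟨ih.map List.cons_injective, ih.map List.cons_injective, by simp⟩

/-- The string of the first `n` bits of `x`. -/
def initialSegment (n : ℕ) (x : Cantor) : List Bool :=
  (List.range n).map x

theorem length_initialSegment (n : ℕ) (x : Cantor) : (initialSegment n x).length = n := by
  simp [initialSegment]

theorem mem_cylinder_iff {σ : List Bool} {x : Cantor} :
    x ∈ cylinder σ ↔ initialSegment σ.length x = σ := by
  simp [cylinder, initialSegment, List.ext_getElem_iff]

theorem measurableSet_cylinder (σ : List Bool) : MeasurableSet (cylinder σ) := by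
  have hinter : cylinder σ = ⋂ (i : ℕ) (h : i < σ.length), (fun x ↦ x i) ⁻¹' {σ[i]} := by
    ext x
    simp [cylinder]
  rw [hinter]
  exact .iInter fun i ↦ .iInter fun _ ↦ measurable_pi_apply i (measurableSet_singleton _)

theorem setOf_initialSegment_eq_biUnion_cylinder (n : ℕ) (p : List Bool → Bool) :
    {x | p (initialSegment n x) = true} =
      ⋃ σ ∈ (strings n).toFinset.filter (p · = true), cylinder σ := by
  ext x
  simp only [mem_ofPred_eq, Finset.mem_filter, List.mem_toFinset, mem_strings, mem_iUnion,
    mem_cylinder_iff, exists_prop]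
  constructor
  · exact fun h ↦ ⟨_, ⟨length_initialSegment n x, h⟩, by rw [length_initialSegment]⟩
  · rintro ⟨σ, ⟨rfl, h⟩, hx⟩
    rwa [hx]

theorem measureReal_setOf_initialSegment (μ : Measure Cantor) [IsFiniteMeasure μ] (n : ℕ)
    (p : List Bool → Bool) :
    μ.real {x | p (initialSegment n x) = true} =
      ((strings n).map fun σ ↦ bif p σ then μ.real (cylinder σ) else 0).sum := by
  have hdisj : PairwiseDisjoint ((strings n).toFinset.filter (p · = true) : Set (List Bool))
      cylinder := by
    intro σ hσ τ hτ hne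
    simp only [Finset.coe_filter, List.mem_toFinset, mem_strings, mem_ofPred_eq] at hσ hτ
    refine disjoint_left.2 fun x hxσ hxτ ↦ hne ?_
    rw [mem_cylinder_iff] at hxσ hxτ
    rw [← hxσ, ← hxτ, hσ.1, hτ.1]
  rw [setOf_initialSegment_eq_biUnion_cylinder,
    measureReal_biUnion_finset hdisj fun σ _ ↦ measurableSet_cylinder σ,
    Finset.sum_filter, ← List.sum_toFinset _ (nodup_strings n)]
  simp only [Bool.cond_eq_ite]

/-- A uniformly computable family of clopen subsets of Cantor space: membership of `x` in `A a` is
decided, uniformly in `a`, by an initial segment of `x` whose length is computable from `a`. -/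
def UniformlyComputableClopen {α : Type} [Primcodable α] (A : α → Set Cantor) : Prop :=
  ∃ (n : α → ℕ) (p : α → List Bool → Bool), Computable n ∧ Computable₂ p ∧
    ∀ a, A a = {x | p a (initialSegment (n a) x) = true}

namespace UniformlyComputableClopen

variable {α β : Type} [Primcodable α] [Primcodable β]

theorem comp {A : β → Set Cantor} (hA : UniformlyComputableClopen A) {u : α → β}
    (hu : Computable u) : UniformlyComputableClopen fun a ↦ A (u a) := by
  obtain ⟨n, p, hn, hp, hAp⟩ := hA
  exact ⟨fun a ↦ n (u a), fun a ↦ p (u a), hn.comp hu, hp.comp (hu.comp .fst) .snd,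
    fun a ↦ hAp (u a)⟩

theorem compl {A : α → Set Cantor} (hA : UniformlyComputableClopen A) :
    UniformlyComputableClopen fun a ↦ (A a)ᶜ := by
  obtain ⟨n, p, hn, hp, hAp⟩ := hA
  refine ⟨n, fun a σ ↦ !p a σ, hn, Primrec.not.to_comp.comp hp, fun a ↦ ?_⟩
  ext x
  simp [hAp]

theorem measurableSet {A : α → Set Cantor} (hA : UniformlyComputableClopen A) (a : α) :
    MeasurableSet (A a) := by
  obtain ⟨n, p, -, -, hAp⟩ := hA
  rw [hAp, setOf_initialSegment_eq_biUnion_cylinder]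
  exact Finset.measurableSet_biUnion _ fun σ _ ↦ measurableSet_cylinder σ

theorem measureReal {A : α → Set Cantor} (hA : UniformlyComputableClopen A) {μ : Measure Cantor}
    [IsFiniteMeasure μ] (hμ : ComputableMeasure μ) :
    UniformlyComputableReal fun a ↦ μ.real (A a) := by
  obtain ⟨n, p, hn, hp, hAp⟩ := hA
  simp only [hAp, measureReal_setOf_initialSegment]
  exact UniformlyComputableReal.list_map_sum
    (r := fun q : α × List Bool ↦ bif p q.1 q.2 then μ.real (cylinder q.2) else 0)
    (primrec_strings.to_comp.comp hn) ((UniformlyComputableReal.comp hμ .snd).cond hp)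

theorem uniformlySigma01_iUnion {A : ℕ × ℕ → Set Cantor} (hA : UniformlyComputableClopen A)
    (z : Cantor) : UniformlySigma01 z fun i ↦ ⋃ k, A (i, k) := by
  obtain ⟨n, p, hn, hp, hAp⟩ := hA
  have hindex : Computable fun q : (ℕ × List Bool) × ℕ ↦ (q.1.1, q.2) :=
    .pair (.comp .fst .fst) .snd
  have hstring : Computable fun q : (ℕ × List Bool) × ℕ ↦ q.1.2 := .comp .snd .fst
  have henum : Computable₂ fun (a : ℕ × List Bool) k ↦
      decide (a.2.length = n (a.1, k)) && p (a.1, k) a.2 :=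
    Primrec.and.to_comp.comp (Primrec.eq.decide.to_comp.comp
      (Computable.list_length.comp hstring) (hn.comp hindex)) (hp.comp hindex hstring)
  refine ⟨_, (rePred_exists henum).recursiveIn, fun i ↦ ?_⟩
  ext x
  simp only [hAp, mem_iUnion, mem_ofPred_eq, Bool.and_eq_true, decide_eq_true_eq, mem_cylinder_iff]
  constructor
  · rintro ⟨k, hk⟩
    exact ⟨_, ⟨k, length_initialSegment _ x, hk⟩, by rw [length_initialSegment]⟩
  · rintro ⟨σ, ⟨k, hσ, hk⟩, hx⟩
    exact ⟨k, by rwa [← hσ, hx]⟩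

end UniformlyComputableClopen

end ClopenSets

section Randomness

theorem MLRandomRel.mlRandom {μ : Measure Cantor} {z x : Cantor} (hx : MLRandomRel μ z x) :
    MLRandom μ x :=
  fun U ⟨⟨W, hW, hU⟩, hμ⟩ ↦ hx U ⟨⟨W, hW.partrec_of_const.recursiveIn, hU⟩, hμ⟩

theorem MLRandomRel.eventually_notMem {μ : Measure Cantor} {z x : Cantor} (hx : MLRandomRel μ z x)
    {A : ℕ → Set Cantor} (hA : UniformlyComputableClopen A)
    (hμ : ∀ k, μ (A k) ≤ (2⁻¹ : ENNReal) ^ k) : ∀ᶠ k in atTop, x ∉ A k := by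
  by_contra hfreq
  simp only [eventually_atTop, not_exists, not_forall, not_not] at hfreq
  have htail : UniformlyComputableClopen fun q : ℕ × ℕ ↦ A (q.1 + q.2 + 1) :=
    hA.comp (Computable.succ.comp Primrec.nat_add.to_comp)
  refine hx _ ⟨htail.uniformlySigma01_iUnion _, fun i ↦ ?_⟩ (mem_iInter.2 fun i ↦ ?_)
  · calc μ (⋃ k, A (i + k + 1)) ≤ ∑' k, μ (A (i + k + 1)) := measure_iUnion_le _
      _ ≤ ∑' k : ℕ, (2⁻¹ : ENNReal) ^ i * 2⁻¹ ^ (k + 1) :=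
        ENNReal.tsum_le_tsum fun k ↦ (hμ _).trans_eq (by rw [← pow_add, add_assoc])
      _ = 2⁻¹ ^ i := by
        rw [ENNReal.tsum_mul_left, ENNReal.tsum_geometric_add_one, ENNReal.one_sub_inv_two,
          inv_inv, ENNReal.inv_mul_cancel two_ne_zero ENNReal.ofNat_ne_top, mul_one]
  · obtain ⟨k, hk, hxk⟩ := hfreq (i + 1)
    refine mem_iUnion.2 ⟨k - (i + 1), ?_⟩
    rwa [show i + (k - (i + 1)) + 1 = k by omega]

end Randomness

section ZeroFrequency

theorem variance_sum_le_of_mem_Icc {Ω ι : Type*} [MeasurableSpace Ω] {μ : Measure Ω}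
    [IsProbabilityMeasure μ] {X : ι → Ω → ℝ} {s : Finset ι} {a b : ℝ}
    (hX : ∀ i ∈ s, AEMeasurable (X i) μ) (hab : ∀ i ∈ s, ∀ᵐ ω ∂μ, X i ω ∈ Icc a b)
    (hindep : Set.Pairwise s fun i j ↦ X i ⟂ᵢ[μ] X j) :
    Var[∑ i ∈ s, X i; μ] ≤ s.card * ((b - a) / 2) ^ 2 := by
  have hLp (i : ι) (hi : i ∈ s) : MemLp (X i) 2 μ :=
    memLp_of_bounded (hab i hi) (hX i hi).aestronglyMeasurable 2
  rw [IndepFun.variance_sum hLp hindep, ← nsmul_eq_mul]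
  exact Finset.sum_le_card_nsmul _ _ _ fun i hi ↦ variance_le_sq_of_bounded (hab i hi) (hX i hi)

instance (p : unitInterval) : IsProbabilityMeasure (bernoulliCantor p) := by
  unfold bernoulliCantor
  infer_instance

/-- The number of zeros among the first `n` bits of `x`. -/
def zeroCount (n : ℕ) (x : Cantor) : ℕ :=
  (initialSegment n x).count false

/-- The indicator function of the event that the `i`-th bit is zero, as a random variable. -/
def zeroIndicator (i : ℕ) (x : Cantor) : ℝ :=
  if x i = false then 1 else 0

theorem zeroCount_eq_sum_zeroIndicator (n : ℕ) (x : Cantor) :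
    (zeroCount n x : ℝ) = (∑ i ∈ Finset.range n, zeroIndicator i) x := by
  induction n with
  | zero => simp [zeroCount, initialSegment]
  | succ n ih =>
    have hsucc : initialSegment (n + 1) x = initialSegment n x ++ [x n] := by
      simp [initialSegment, List.range_succ]
    rw [zeroCount, hsucc, List.count_append, Finset.sum_range_succ, Pi.add_apply, ← ih]
    cases h : x n <;> simp [zeroCount, zeroIndicator, h]

theorem measurable_zeroIndicator (i : ℕ) : Measurable (zeroIndicator i) :=
  (Measurable.of_discrete (f := fun b ↦ if b = false then (1 : ℝ) else 0)).comp
    (measurable_pi_apply i)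

theorem zeroIndicator_mem_Icc (i : ℕ) (x : Cantor) : zeroIndicator i x ∈ Icc (0 : ℝ) 1 := by
  unfold zeroIndicator
  split_ifs <;> simp

theorem iIndepFun_zeroIndicator (p : unitInterval) :
    iIndepFun zeroIndicator (bernoulliCantor p) :=
  iIndepFun_infinitePi (X := fun _ b ↦ if b = false then (1 : ℝ) else 0) fun _ ↦ .of_discrete

theorem integral_zeroIndicator (p : unitInterval) (i : ℕ) :
    ∫ x, zeroIndicator i x ∂bernoulliCantor p = p := by
  have hbit : MeasurePreserving (fun x : Cantor ↦ x i) (bernoulliCantor p)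
      (bernoulliMeasure false true p) :=
    measurePreserving_eval_infinitePi (fun _ : ℕ ↦ bernoulliMeasure false true p) i
  have hmap := integral_map (μ := bernoulliCantor p)
    (f := fun b : Bool ↦ if b = false then (1 : ℝ) else 0) hbit.measurable.aemeasurable .of_discrete
  rw [hbit.map_eq, integral_bernoulliMeasure] at hmap
  simpa [zeroIndicator] using hmap.symm

theorem bernoulliCantor_zeroCount_deviation_le (p : unitInterval) (n : ℕ) {t : ℝ} (ht : 0 < t) :
    bernoulliCantor p {x | t ≤ |(zeroCount n x : ℝ) - n * p|} ≤
      ENNReal.ofReal (n / 4 / t ^ 2) := by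
  have hLp (i : ℕ) : MemLp (zeroIndicator i) 2 (bernoulliCantor p) :=
    memLp_of_bounded (ae_of_all _ (zeroIndicator_mem_Icc i))
      (measurable_zeroIndicator i).aestronglyMeasurable 2
  have hmean : ∫ x, (∑ i ∈ Finset.range n, zeroIndicator i) x ∂bernoulliCantor p = n * p := by
    simp only [Finset.sum_apply]
    rw [integral_finsetSum _ fun i _ ↦ (hLp i).integrable one_le_two]
    simp [integral_zeroIndicator]
  have hvar : Var[∑ i ∈ Finset.range n, zeroIndicator i; bernoulliCantor p] ≤ n / 4 := by
    refine (variance_sum_le_of_mem_Icc (fun i _ ↦ (measurable_zeroIndicator i).aemeasurable)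
      (fun i _ ↦ ae_of_all _ (zeroIndicator_mem_Icc i))
      fun i _ j _ hij ↦ (iIndepFun_zeroIndicator p).indepFun hij).trans_eq ?_
    rw [Finset.card_range]
    ring
  have hchebyshev := meas_ge_le_variance_div_sq
    (memLp_finsetSum' (Finset.range n) fun i _ ↦ hLp i) ht
  rw [hmean] at hchebyshev
  simp only [← zeroCount_eq_sum_zeroIndicator] at hchebyshev
  exact hchebyshev.trans (ENNReal.ofReal_le_ofReal (by gcongr))

/-- The set of sequences whose number of zeros among the first `n` bits is within `r` of `c`. -/
def zeroCountBall (n c r : ℕ) : Set Cantor :=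
  {x | |(zeroCount n x : ℝ) - c| < r}

theorem uniformlyComputableClopen_zeroCountBall {α : Type} [Primcodable α] {n c r : α → ℕ}
    (hn : Computable n) (hc : Computable c) (hr : Computable r) :
    UniformlyComputableClopen fun a ↦ zeroCountBall (n a) (c a) (r a) := by
  have hcount : Computable fun q : α × List Bool ↦ q.2.count false :=
    (primrec_list_count false).to_comp.comp .snd
  have hr' : Computable fun q : α × List Bool ↦ r q.1 := hr.comp .fst
  have hc' : Computable fun q : α × List Bool ↦ c q.1 := hc.comp .fst
  refine ⟨n, fun a σ ↦ decide (c a < σ.count false + r a) && decide (σ.count false < c a + r a),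
    hn, Primrec.and.to_comp.comp
      (Primrec.nat_lt.decide.to_comp.comp hc' (Primrec.nat_add.to_comp.comp hcount hr'))
      (Primrec.nat_lt.decide.to_comp.comp hcount (Primrec.nat_add.to_comp.comp hc' hr')),
    fun a ↦ ?_⟩
  ext x
  simp only [zeroCountBall, zeroCount, mem_ofPred_eq, Bool.and_eq_true, decide_eq_true_eq, abs_lt,
    ← Nat.cast_lt (α := ℝ), Nat.cast_add]
  constructor <;> rintro ⟨h₁, h₂⟩ <;> constructor <;> linarith

theorem disjoint_zeroCountBall {n c c' r : ℕ} (h : c + 2 * r ≤ c') :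
    Disjoint (zeroCountBall n c r) (zeroCountBall n c' r) := by
  have h' : (c : ℝ) + 2 * r ≤ c' := by exact_mod_cast h
  refine disjoint_left.2 fun x hx hx' ↦ ?_
  simp only [zeroCountBall, mem_ofPred_eq, abs_lt] at hx hx'
  linarith

theorem bernoulliCantor_compl_zeroCountBall_le (p : unitInterval) {n c r : ℕ} (hr : 0 < r)
    (hpc : |n * (p : ℝ) - c| ≤ r / 2) :
    bernoulliCantor p (zeroCountBall n c r)ᶜ ≤ ENNReal.ofReal (n / r ^ 2) := by
  have hr' : (0 : ℝ) < r := by exact_mod_cast hr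
  have hsub : (zeroCountBall n c r)ᶜ ⊆ {x | (r / 2 : ℝ) ≤ |(zeroCount n x : ℝ) - n * p|} := by
    intro x hx
    have hxc : (r : ℝ) ≤ |(zeroCount n x : ℝ) - c| := not_lt.1 hx
    have := abs_sub_le (zeroCount n x : ℝ) (n * p) c
    rw [mem_ofPred_eq]
    linarith
  refine (measure_mono hsub).trans
    ((bernoulliCantor_zeroCount_deviation_le p n (half_pos hr')).trans_eq ?_)
  congr 1
  field_simp
  norm_num

end ZeroFrequency

section DyadicConstruction

/-- The dyadic interval of the numbers that exceed `m / 2 ^ d` by at most a quarter of `2 ^ (-d)`.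
The factor `1 / 4` keeps them well inside the interval of radius `2 ^ (-d - 1)` about `m / 2 ^ d`,
so that Chebyshev's inequality applies uniformly. -/
def dyadicWindow (d m : ℕ) : Set ℝ :=
  Icc (m / 2 ^ d) ((m + 1 / 4) / 2 ^ d)

theorem dyadicWindow_subset {d m t j : ℕ} (hj : j < 2 ^ t) :
    dyadicWindow (d + (t + 2)) (m * 2 ^ (t + 2) + j) ⊆ dyadicWindow d m := by
  have hj' : (j : ℝ) + 1 ≤ 2 ^ t := by exact_mod_cast hj
  have hfour : (2 : ℝ) ^ (t + 2) = 4 * 2 ^ t := by ring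
  have hscale (a : ℝ) : a / 2 ^ d = a * 2 ^ (t + 2) / 2 ^ (d + (t + 2)) := by
    rw [pow_add 2 d, mul_div_mul_right _ _ (by positivity)]
  rw [dyadicWindow, dyadicWindow, hscale m, hscale (m + 1 / 4)]
  refine Icc_subset_Icc ?_ ?_ <;> gcongr <;> push_cast
  · exact le_add_of_nonneg_right j.cast_nonneg
  · linarith

theorem dyadicWindow_zero_zero_subset_unitInterval : dyadicWindow 0 0 ⊆ unitInterval :=
  Icc_subset_Icc (by norm_num) (by norm_num)

theorem abs_sub_div_le_of_mem_dyadicWindow {d m : ℕ} {x : ℝ} (hx : x ∈ dyadicWindow d m) :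
    |x - m / 2 ^ d| ≤ 1 / 4 / 2 ^ d := by
  rw [dyadicWindow, mem_Icc, add_div] at hx
  rw [abs_of_nonneg (sub_nonneg.2 hx.1)]
  linarith

theorem exists_computableReal_mem_dyadicWindow {d m : ℕ → ℕ} (hd : Computable d)
    (hm : Computable m) (hle : ∀ k, k ≤ d k)
    (hnested : ∀ k, dyadicWindow (d (k + 1)) (m (k + 1)) ⊆ dyadicWindow (d k) (m k)) :
    ∃ c : ℝ, ComputableReal c ∧ ∀ k, c ∈ dyadicWindow (d k) (m k) := by
  obtain ⟨c, hc⟩ := IsCompact.nonempty_iInter_of_sequence_nonempty_isCompact_isClosed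
    (fun k ↦ dyadicWindow (d k) (m k)) hnested
    (fun k ↦ nonempty_Icc.2 (by gcongr; norm_num)) isCompact_Icc fun _ ↦ isClosed_Icc
  rw [mem_iInter] at hc
  refine ⟨c, UniformlyComputableReal.of_dyadic_approx (f := fun _ n ↦ m n) (g := fun _ _ ↦ 0)
    (e := fun _ n ↦ d n) (hm.comp .snd) (.const 0) (hd.comp .snd) fun _ n ↦ ?_, hc⟩
  rw [Nat.cast_zero, sub_zero]
  refine (abs_sub_div_le_of_mem_dyadicWindow (hc n)).trans ?_
  gcongr
  · norm_num
  · exact one_le_two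
  · exact hle n

/-- The event that the frequency of zeros among the first `2 ^ (2 * d + k + 2)` bits is within
`2 ^ (-d - 1)` of `m / 2 ^ d`. The length is such that, by Chebyshev's inequality, this event has
Bernoulli `p`-probability at least `1 - 2 ^ (-k)` for all `p ∈ dyadicWindow d m`. -/
def frequencyEvent (d k m : ℕ) : Set Cantor :=
  zeroCountBall (2 ^ (2 * d + k + 2)) (m * 2 ^ (d + k + 2)) (2 ^ (d + k + 1))

theorem uniformlyComputableClopen_frequencyEvent {α : Type} [Primcodable α] {d k m : α → ℕ}
    (hd : Computable d) (hk : Computable k) (hm : Computable m) :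
    UniformlyComputableClopen fun a ↦ frequencyEvent (d a) (k a) (m a) := by
  have hadd {u v : α → ℕ} (hu : Computable u) (hv : Computable v) :
      Computable fun a ↦ u a + v a := Primrec.nat_add.to_comp.comp hu hv
  have hdk : Computable fun a ↦ d a + k a := hadd hd hk
  exact uniformlyComputableClopen_zeroCountBall
    (computable_two_pow (hadd (hadd (Primrec.nat_double.to_comp.comp hd) hk) (.const 2)))
    (Primrec.nat_mul.to_comp.comp hm (computable_two_pow (hadd hdk (.const 2))))
    (computable_two_pow (hadd hdk (.const 1)))

theorem pairwise_disjoint_frequencyEvent (d k : ℕ) :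
    Pairwise (Function.onFun Disjoint (frequencyEvent d k)) := by
  refine (pairwise_disjoint_on _).2 fun m m' hmm' ↦ disjoint_zeroCountBall ?_
  calc m * 2 ^ (d + k + 2) + 2 * 2 ^ (d + k + 1) = (m + 1) * 2 ^ (d + k + 2) := by ring
    _ ≤ m' * 2 ^ (d + k + 2) := Nat.mul_le_mul_right _ hmm'

theorem ofReal_inv_two_pow (k : ℕ) : ENNReal.ofReal (2⁻¹ ^ k) = 2⁻¹ ^ k := by
  rw [ENNReal.ofReal_pow (by norm_num), ENNReal.ofReal_inv_of_pos two_pos, ENNReal.ofReal_ofNat]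

theorem bernoulliCantor_compl_frequencyEvent_le {p : unitInterval} {d m : ℕ}
    (hp : (p : ℝ) ∈ dyadicWindow d m) (k : ℕ) :
    bernoulliCantor p (frequencyEvent d k m)ᶜ ≤ (2⁻¹ : ENNReal) ^ k := by
  have hcenter : |((2 ^ (2 * d + k + 2) : ℕ) : ℝ) * p - (m * 2 ^ (d + k + 2) : ℕ)| ≤
      (2 ^ (d + k + 1) : ℕ) / 2 := by
    have hscale : ((2 ^ (2 * d + k + 2) : ℕ) : ℝ) * p - (m * 2 ^ (d + k + 2) : ℕ) =
        2 ^ (2 * d + k + 2) * (p - m / 2 ^ d) := by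
      push_cast
      field_simp
      ring
    rw [hscale, abs_mul, abs_of_nonneg (by positivity)]
    refine (mul_le_mul_of_nonneg_left (abs_sub_div_le_of_mem_dyadicWindow hp)
      (by positivity)).trans_eq ?_
    push_cast
    field_simp
    ring
  refine (bernoulliCantor_compl_zeroCountBall_le p (by positivity) hcenter).trans_eq ?_
  have hbound : ((2 ^ (2 * d + k + 2) : ℕ) : ℝ) / (2 ^ (d + k + 1) : ℕ) ^ 2 = 2⁻¹ ^ k := by
    push_cast
    rw [inv_pow]
    field_simp
    ring
  rw [hbound, ofReal_inv_two_pow]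

theorem exists_measureReal_lt_of_pairwiseDisjoint {Ω ι : Type*} [MeasurableSpace Ω]
    {μ : Measure Ω} [IsFiniteMeasure μ] {s : Finset ι} {A : ι → Set Ω} {ε : ℝ}
    (hA : ∀ i ∈ s, MeasurableSet (A i)) (hdisj : PairwiseDisjoint s A)
    (hε : μ.real univ < s.card * ε) : ∃ i ∈ s, μ.real (A i) < ε := by
  refine Finset.exists_lt_of_sum_lt ?_
  rw [Finset.sum_const, nsmul_eq_mul, ← measureReal_biUnion_finset hdisj hA]
  exact (measureReal_mono (subset_univ _)).trans_lt hε

theorem exists_computable_light_centers {ξ : Measure Cantor} [IsFiniteMeasure ξ]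
    (hξ : ComputableMeasure ξ) {d t : ℕ → ℕ} (hd : Computable d) (ht : Computable t)
    (hlarge : ∀ k, ξ.real univ < 2 ^ t k * 2⁻¹ ^ k) :
    ∃ m : ℕ → ℕ, Computable m ∧ m 0 = 0 ∧ ∀ k,
      (∃ j < 2 ^ t k, m (k + 1) = m k * 2 ^ (t k + 2) + j) ∧
        ξ (frequencyEvent (d (k + 1)) k (m (k + 1))) ≤ 2⁻¹ ^ k := by
  let next (q : ℕ × ℕ) (j : ℕ) : ℕ := q.2 * 2 ^ (t q.1 + 2) + j
  have hnext : Computable₂ next :=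
    Primrec.nat_add.to_comp.comp (Primrec.nat_mul.to_comp.comp (.comp .snd .fst)
      (computable_two_pow (Primrec.nat_add.to_comp.comp (ht.comp (.comp .fst .fst)) (.const 2))))
      .snd
  have hevent : UniformlyComputableClopen fun q : (ℕ × ℕ) × ℕ ↦
      frequencyEvent (d (q.1.1 + 1)) q.1.1 (next q.1 q.2) :=
    uniformlyComputableClopen_frequencyEvent (hd.comp (Computable.succ.comp (.comp .fst .fst)))
      (.comp .fst .fst) hnext
  have hexists (q : ℕ × ℕ) : ∃ j < 2 ^ t q.1,
      ξ.real (frequencyEvent (d (q.1 + 1)) q.1 (next q j)) < 2⁻¹ ^ q.1 := by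
    obtain ⟨j, hj, hlt⟩ := exists_measureReal_lt_of_pairwiseDisjoint (μ := ξ)
      (s := Finset.range (2 ^ t q.1)) (ε := 2⁻¹ ^ q.1)
      (A := fun j ↦ frequencyEvent (d (q.1 + 1)) q.1 (next q j))
      (fun j _ ↦ hevent.measurableSet (q, j))
      (fun i _ j _ hij ↦ pairwise_disjoint_frequencyEvent _ _ (by simpa [next] using hij))
      (by simpa using hlarge q.1)
    exact ⟨j, Finset.mem_range.1 hj, hlt⟩
  obtain ⟨f, hf, hlight⟩ := UniformlyComputableReal.exists_computable_selection
    (hevent.measureReal hξ) (.inv_two_pow .fst) (computable_two_pow (ht.comp .fst)) hexists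
  let m (k : ℕ) : ℕ := Nat.rec 0 (fun k s ↦ next (k, s) (f (k, s))) k
  refine ⟨m, Computable.nat_rec (h := fun (_ : ℕ) q ↦ next q (f q)) .id (.const 0)
    (hnext.comp .snd (hf.comp .snd)), rfl, fun k ↦ ⟨⟨f (k, m k), (hlight (k, m k)).1, rfl⟩, ?_⟩⟩
  rw [← ofReal_inv_two_pow, ← ofReal_measureReal]
  exact ENNReal.ofReal_le_ofReal (hlight (k, m k)).2.le

end DyadicConstruction

end CantorRandomness

open MeasureTheory CantorRandomness in
theorem mainTheorem4_general (ξ : Measure Cantor) [IsFiniteMeasure ξ] (hξ : ComputableMeasure ξ) :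
    ∃ c : unitInterval, ComputableReal (c : ℝ) ∧
      ∀ x, MLRandom ξ x → ¬ MLRandom (bernoulliCantor c) x := by
  obtain ⟨e, he⟩ := pow_unbounded_of_one_lt (ξ.real Set.univ) one_lt_two
  let t (k : ℕ) : ℕ := 2 * k + e
  -- The solution of `d (k + 1) = d k + (t k + 2)` with `d 0 = 0`.
  let d (k : ℕ) : ℕ := k * (k + e + 1)
  have hd : Computable d :=
    (Primrec.nat_mul.comp .id (Primrec.succ.comp (Primrec.nat_add.comp .id (.const e)))).to_comp
  have ht : Computable t := (Primrec.nat_add.comp .nat_double (.const e)).to_comp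
  have hlarge (k : ℕ) : ξ.real Set.univ < 2 ^ t k * 2⁻¹ ^ k := by
    refine he.trans_le ?_
    rw [inv_pow, ← div_eq_mul_inv, le_div_iff₀ (by positivity), ← pow_add]
    exact pow_le_pow_right₀ one_le_two (by simp only [t]; omega)
  obtain ⟨m, hm, hm0, hlight⟩ := exists_computable_light_centers hξ hd ht hlarge
  have hnested (k : ℕ) : dyadicWindow (d (k + 1)) (m (k + 1)) ⊆ dyadicWindow (d k) (m k) := by
    obtain ⟨j, hj, hmk⟩ := (hlight k).1
    rw [hmk, show d (k + 1) = d k + (t k + 2) by ring]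
    exact dyadicWindow_subset hj
  obtain ⟨c, hc, hcm⟩ := exists_computableReal_mem_dyadicWindow hd hm
    (fun k ↦ Nat.le_mul_of_pos_right k (Nat.succ_pos _)) hnested
  have hcI : c ∈ unitInterval :=
    dyadicWindow_zero_zero_subset_unitInterval (by simpa [d, hm0] using hcm 0)
  have hA : UniformlyComputableClopen fun k ↦ frequencyEvent (d (k + 1)) k (m (k + 1)) :=
    uniformlyComputableClopen_frequencyEvent (hd.comp .succ) .id (hm.comp .succ)
  refine ⟨⟨c, hcI⟩, hc, fun x hx hx' ↦ ?_⟩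
  obtain ⟨k, hk, hk'⟩ := ((hx.eventually_notMem hA fun k ↦ (hlight k).2).and
    (hx'.eventually_notMem hA.compl fun k ↦
      bernoulliCantor_compl_frequencyEvent_le (hcm (k + 1)) k)).exists
  exact hk' hk

theorem mainTheorem4 :
    ¬ ∃ ξ : MeasureTheory.Measure CantorRandomness.Cantor,
        MeasureTheory.IsProbabilityMeasure ξ ∧
        CantorRandomness.ComputableMeasure ξ ∧
        ∀ c : unitInterval, CantorRandomness.ComputableReal (c : ℝ) →
          ∃ x : CantorRandomness.Cantor,
            CantorRandomness.MLRandom ξ x ∧ CantorRandomness.BernoulliRandom c x := by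
  rintro ⟨ξ, _, hξ, h⟩
  obtain ⟨c, hc, hdisjoint⟩ := mainTheorem4_general ξ hξ
  obtain ⟨x, hx, hx'⟩ := h c hc
  exact hdisjoint x hx hx'.mlRandom
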